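/- **Notation.** Let $\mathbb N^*=\{1,2,\dots\}$ and $\mathbb T=\mathbb R/\mathbb Z$. For an abelian group $X$, a non-empty subset $E\subset X$ and $\eta\in X$, let $v^E_\eta$ be the operator in $\ell^2(E)$ given by $(v^E_\eta f)(\xi)=f(\xi-\eta)$ if $\xi-\eta\in E$ and $(v^E_\eta f)(\xi)=0$ otherwise. For $\varphi\in\ell^1(X)$ put $$T^E_\varphi=\sum_{\eta\in X}\varphi(\eta)\,v^E_\eta,\qquad V^E_\varphi=\sum_{\eta\in X}\varphi(\eta)\,v^E_\eta(v^E_\eta)^*,$$ the series converging in operator norm. Write $T^<_\varphi,V^<_\varphi$ when $X=\mathbb Z^N$ and $E=\mathbb Z^N_<:=\{y\in\mathbb Z^N: y_1<\dots<y_N\}$, and $T^{d}_\varphi,V^{d}_\varphi$ when $X=\mathbb Z^{d}$ and $E=(\mathbb N^*)^{d}$ (for $d=0$: $X=E=\{0\}$, so $T^0_\varphi=V^0_\varphi=\varphi$ acting in $\mathbb C$). For $\rho\in\ell^1(\mathbb Z^N)$ and $\tau\in\mathbb T$ define $\mu(\tau)\rho\in\ell^1(\mathbb Z^{N-1})$ by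 $$[\mu(\tau)\rho](z_2,\dots,z_N)=\sum_{z_1\in\mathbb Z}e^{-2\pi i z_1\tau}\,\rho(z_1,\,z_1+z_2,\,\dots,\,z_1+\dots+z_N),$$ and for $j\in\{2,\dots,N\}$, $\varrho\in\ell^1(\mathbb Z^{N-1})$ and $\tau'\in\mathbb T$ define $\nu_j(\tau')\varrho\in\ell^1(\mathbb Z^{N-2})$ by $$[\nu_j(\tau')\varrho](z_2,\dots,z_{j-1},z_{j+1},\dots,z_N)=\sum_{z_j\in\mathbb Z}e^{-2\pi i z_j\tau'}\,\varrho(z_2,\dots,z_N).$$ For $\varphi,\psi\in\ell^1(\mathbb Z^N)$ let $\Sigma_j(\tau,\tau')$ be the spectrum of the operator $T^{N-2}_{\nu_j(\tau')\mu(\tau)\varphi}+V^{N-2}_{\nu_j(0)\mu(0)\psi}$ in $\ell^2\big((\mathbb N^*)^{N-2}\big)$. **Theorem 5.1 (non-propagation).** Let $N\ge2$ and fix $j\in\{2,\dots,N\}$. Let $\varphi,\psi\in\ell^1(\mathbb Z^N)$ be real-valued with $\varphi(-\eta)=\varphi(\eta)$ for all $\eta\in\mathbb Z^N$, so that $T^<_\varphi+V^<_\psi$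 is a bounded self-adjoint operator in $\ell^2(\mathbb Z^N_<)$. For $n\in\mathbb N$ set $$\Omega_j(n)=\{y\in\mathbb Z^N_<:\ y_j-y_{j-1}\ge n\}.$$ Let $\kappa:\mathbb R\to\mathbb R$ be a continuous function with $$\operatorname{supp}\kappa\ \cap\bigcup_{\tau,\tau'\in\mathbb T}\Sigma_j(\tau,\tau')=\varnothing .$$ Then for each $\varepsilon>0$ there is $n_\varepsilon\in\mathbb N$ such that $$\big\|\chi_{\Omega_j(n)}\,\kappa\big(T^<_\varphi+V^<_\psi\big)\big\|\le\varepsilon\qquad\text{for all } n\ge n_\varepsilon,$$ where $\chi_{\Omega_j(n)}$ is the operator of multiplication by the characteristic function of $\Omega_j(n)$ in $\ell^2(\mathbb Z^N_<)$, $\kappa(\cdot)$ is the continuous functional calculus and the norm is the operator norm. -/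

import Mathlib

open scoped ENNReal

noncomputable section

namespace ToeplitzLattice

/-- The complex Hilbert space `ℓ²(α)` of a (discrete) index set `α`, with the norm and inner
product of Mathlib's `lp`. -/
def ell2 (α : Type*) : Type _ := lp (fun _ : α => ℂ) 2

instance (α : Type*) : NormedAddCommGroup (ell2 α) :=
  inferInstanceAs (NormedAddCommGroup (lp (fun _ : α => ℂ) 2))

instance (α : Type*) : InnerProductSpace ℂ (ell2 α) :=
  inferInstanceAs (InnerProductSpace ℂ (lp (fun _ : α => ℂ) 2))

instance (α : Type*) : CompleteSpace (ell2 α) :=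
  inferInstanceAs (CompleteSpace (lp (fun _ : α => ℂ) 2))

instance (α : Type*) : CoeFun (ell2 α) (fun _ => α → ℂ) :=
  ⟨fun f => ((show lp (fun _ : α => ℂ) 2 from f) : α → ℂ)⟩

theorem memℓp_comp {α β : Type*} {g : α → β} (hg : Function.Injective g)
    (f : lp (fun _ : β => ℂ) 2) : Memℓp (fun a => f (g a)) 2 := by
  have h := (lp.memℓp f).summable (by norm_num)
  exact memℓp_gen (h.comp_injective hg)

theorem norm_comp_le {α β : Type*} {g : α → β} (hg : Function.Injective g)
    (f : lp (fun _ : β => ℂ) 2) :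
    ‖(⟨fun a => f (g a), memℓp_comp hg f⟩ : lp (fun _ : α => ℂ) 2)‖ ≤ ‖f‖ := by
  have h := (lp.memℓp f).summable (by norm_num)
  have h2 : (0 : ℝ) < (2 : ℝ≥0∞).toReal := by norm_num
  rw [← Real.rpow_le_rpow_iff (norm_nonneg _) (norm_nonneg _) h2,
    lp.norm_rpow_eq_tsum h2, lp.norm_rpow_eq_tsum h2]
  exact (h.comp_injective hg).tsum_le_tsum_of_inj g hg
    (fun c _ => Real.rpow_nonneg (norm_nonneg _) _) (fun _ => le_rfl) h

/-- Composition `f ↦ f ∘ g` with an injective map `g : α → β`, as a bounded operator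
`ℓ²(β) → ℓ²(α)`. -/
def compOp {α β : Type*} (g : α → β) (hg : Function.Injective g) : ell2 β →L[ℂ] ell2 α :=
  LinearMap.mkContinuous
    { toFun := fun f => (⟨fun a => f (g a), memℓp_comp hg f⟩ : lp (fun _ : α => ℂ) 2)
      map_add' := fun _ _ => rfl
      map_smul' := fun _ _ => rfl }
    1 (fun f => (norm_comp_le hg f).trans_eq (one_mul _).symm)

/-- The restriction operator `ℓ²(α) → ℓ²(S)` for a subset `S` of `α`. Its adjoint is the
extension by zero, that is, the usual embedding of `ℓ²(S)` as a subspace of `ℓ²(α)`. -/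
def restrictOp {α : Type*} (S : Set α) : ell2 α →L[ℂ] ell2 S :=
  compOp (Subtype.val : S → α) Subtype.val_injective

/-- The operator of multiplication by the characteristic function `χ_S` in `ℓ²(α)`. -/
def charOp {α : Type*} (S : Set α) : ell2 α →L[ℂ] ell2 α :=
  (restrictOp S).adjoint ∘L restrictOp S

section Toeplitz

variable {X : Type*} [AddCommGroup X]

/-- The bilateral shift `(u_η f)(ξ) = f (ξ - η)` in `ℓ²(X)`. -/
def bilateralShift (η : X) : ell2 X →L[ℂ] ell2 X :=
  compOp (fun ξ : X => ξ - η) (sub_left_injective (b := η))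

/-- The unilateral shift `v_η^E = P^E u_η ↾ ℓ²(E)` in `ℓ²(E)`. -/
def unilateralShift (E : Set X) (η : X) : ell2 E →L[ℂ] ell2 E :=
  restrictOp E ∘L bilateralShift η ∘L (restrictOp E).adjoint

/-- The Toeplitz operator `T_φ^E = ∑_η φ(η) v_η^E` (a norm convergent series if `φ ∈ ℓ¹(X)`). -/
def toeplitzOp (E : Set X) (φ : X → ℂ) : ell2 E →L[ℂ] ell2 E :=
  ∑' η, φ η • unilateralShift E η

/-- The potential `V_ψ^E = ∑_η ψ(η) v_η^E (v_η^E)^*` (a norm convergent series if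
`ψ ∈ ℓ¹(X)`). -/
def potentialOp (E : Set X) (ψ : X → ℂ) : ell2 E →L[ℂ] ell2 E :=
  ∑' η, ψ η • (unilateralShift E η ∘L (unilateralShift E η).adjoint)

end Toeplitz

/-- `ℤ^N_<`, the set of strictly increasing `N`-tuples of integers. -/
def increasingTuples (N : ℕ) : Set (Fin N → ℤ) := {x | StrictMono x}

/-- `(ℕ^*)^d` as a subset of `ℤ^d`, where `ℕ^* = {1, 2, …}`. For `d = 0` it is all of the
one-point group. -/
def positiveTuples (d : ℕ) : Set (Fin d → ℤ) := {z | ∀ i, 1 ≤ z i}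

/-- The inverse `θ⁻¹(z₁, …, z_N) = (z₁, z₁ + z₂, …, z₁ + ⋯ + z_N)` of the automorphism
`θ(y₁, …, y_N) = (y₁, y₂ - y₁, …, y_N - y_{N-1})` of `ℤ^N`. -/
def thetaInv {N : ℕ} (z : Fin N → ℤ) : Fin N → ℤ := fun i => ∑ k ∈ Finset.Iic i, z k

/-- The Fourier transform `(𝓕 f)(τ) = ∑_z e^{-2πi z τ} f(z)` of `f ∈ ℓ¹(ℤ)`, for `τ` in the
circle `𝕋 = ℝ/ℤ`. -/
def fourierZ (f : ℤ → ℂ) (τ : UnitAddCircle) : ℂ := ∑' z : ℤ, fourier (-z) τ * f z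

/-- `μ(τ)ρ = [𝓕₁(ρ ∘ θ⁻¹)](τ, ·)`: change of variables, then Fourier transform in the first
variable. -/
def mu {d : ℕ} (τ : UnitAddCircle) (ρ : (Fin (d + 1) → ℤ) → ℂ) : (Fin d → ℤ) → ℂ :=
  fun z => fourierZ (fun z₁ => ρ (thetaInv (Fin.cons z₁ z))) τ

/-- Fourier transform at `τ'` in the variable with (zero-based) position `i`, the other variables
being kept in their order. -/
def nu {d : ℕ} (i : Fin (d + 1)) (τ' : UnitAddCircle) (ρ : (Fin (d + 1) → ℤ) → ℂ) :
    (Fin d → ℤ) → ℂ :=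
  fun w => fourierZ (fun t => ρ (i.insertNth t w)) τ'

/-- The set `Σ_j(τ, τ')` for `N = m + 2` and `j = i + 2`: the spectrum of
`T_{ν_j(τ')μ(τ)φ} + V_{ν_j(0)μ(0)ψ}` in `ℓ²((ℕ^*)^{N-2})`. The variables `(z₂, …, z_N)` of
`μ(τ)φ` have zero-based positions `0, …, m`, so that `z_j` has position `i = j - 2`. -/
def SigmaSet {m : ℕ} (i : Fin (m + 1)) (φ ψ : (Fin (m + 2) → ℤ) → ℂ) (τ τ' : UnitAddCircle) :
    Set ℂ :=
  spectrum ℂ (toeplitzOp (positiveTuples m) (nu i τ' (mu τ φ)) +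
    potentialOp (positiveTuples m) (nu i 0 (mu 0 ψ)))

/-- The set `Ω_j(n) = {y ∈ ℤ^N_< : y_j - y_{j-1} ≥ n}` for `N = m + 2` and `j = i + 2`. The
components `y_{j-1}` and `y_j` have zero-based positions `i` and `i + 1`. -/
def Omega {m : ℕ} (i : Fin (m + 1)) (n : ℕ) : Set (increasingTuples (m + 2)) :=
  {y | (n : ℤ) ≤ y.1 i.succ - y.1 i.castSucc}

/-- The operator `T_φ^< + V_ψ^<` in `ℓ²(ℤ^N_<)`. -/
def hamiltonian (N : ℕ) (φ ψ : (Fin N → ℤ) → ℂ) :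
    ell2 (increasingTuples N) →L[ℂ] ell2 (increasingTuples N) :=
  toeplitzOp (increasingTuples N) φ + potentialOp (increasingTuples N) ψ

end ToeplitzLattice

end

/-!
Write `H = T_φ^< + V_ψ^<`. Far out in `Ω_j(n)` the constraint `y_{j-1} < y_j` is not felt, and `H`
acts there like the operator `H_∞` given by the same `φ`, `ψ` on the larger set of tuples that
increase at every step except possibly the one from `y_{j-1}` to `y_j`. The operator `H_∞` is
invariant under translations in two directions, and Fourier transforms in these directions (`μ`,
then `ν_j`) decompose it into the operators `H(τ, τ')` whose spectra are the sets `Σ_j(τ, τ')`.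

Let `p` be a real polynomial that is uniformly `δ`-close to `κ` on an interval which contains the
spectra of all these self-adjoint operators. Since `κ` vanishes on `Σ_j(τ, τ')`, the operators
`p(H(τ, τ'))` have norm at most `δ`, hence so has `p(H_∞)`, and `κ(H)` is `δ`-close to `p(H)`. Thus
only the comparison of `p(H)` with `p(H_∞)` far out is needed, and the functional calculus of
`H_∞` and the spectrum of a direct integral are avoided.

* `Layering.norm_aeval_le` bounds `p(T + V)` by the same polynomial in the fibre operators. The
  relation `Layering.Decomposes` between an operator and its family of fibres is compatible with
  sums, products and norm convergent series, and Parseval's identity with coefficients in a Hilbert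
  space (`integral_norm_sq_fourierSum`) turns it into a norm estimate
  (`Layering.Decomposes.norm_le`).
* `AgreesFar` says that two operators agree asymptotically far out and that the first one is
  asymptotically local. Locality makes this relation compatible with products, and so with
  polynomials. Shifts have finite range, so it holds for them
  (`agreesFar_unilateralShift`), and therefore for `H` and `H_∞`
  (`agreesFar_toeplitzOp_add_potentialOp`).
-/

noncomputable section

namespace ToeplitzLattice

/-! ### Operators on `ℓ²` and shifts -/

section Ell2

variable {α β : Type*}

theorem ell2_ext {f g : ell2 α} (h : ∀ a, f a = g a) : f = g :=
  lp.ext (funext h)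

@[simp] theorem ell2_sub_apply (f g : ell2 α) (a : α) : (f - g) a = f a - g a := rfl

@[simp] theorem ell2_zero_apply (a : α) : (0 : ell2 α) a = 0 := rfl

theorem ell2_hasSum_norm_sq (f : ell2 α) : HasSum (fun a => ‖f a‖ ^ 2) (‖f‖ ^ 2) := by
  have h := lp.hasSum_norm (p := 2) (by norm_num) (show lp (fun _ : α => ℂ) 2 from f)
  simp only [ENNReal.toReal_ofNat, Real.rpow_ofNat] at h
  exact h

open Classical in
/-- The vector of `ℓ²(α)` that equals `c` at `a` and vanishes elsewhere. -/
def ell2Single (a : α) (c : ℂ) : ell2 α := lp.single (E := fun _ : α => ℂ) 2 a c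

open Classical in
theorem ell2Single_apply (a : α) (c : ℂ) (b : α) :
    ell2Single a c b = if b = a then c else 0 := by
  change (lp.single (E := fun _ : α => ℂ) 2 a c : α → ℂ) b = _
  rw [lp.single_apply]
  by_cases h : b = a
  · subst h; simp
  · simp [h]

theorem ell2_hasSum_single (f : ell2 α) : HasSum (fun a => ell2Single a (f a)) f := by
  classical
  exact lp.hasSum_single (p := 2) (by norm_num) (show lp (fun _ : α => ℂ) 2 from f)

theorem inner_ell2Single (a : α) (f : ell2 α) : inner ℂ (ell2Single a 1) f = f a := by
  classical
  have h := lp.inner_single_left (𝕜 := ℂ) a (1 : ℂ) (show lp (fun _ : α => ℂ) 2 from f)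
  have h2 : inner ℂ (1 : ℂ) (f a) = f a := by simp
  rw [← h2, ← h]
  unfold ell2Single
  congr!

@[simp] theorem compOp_apply (g : α → β) (hg : Function.Injective g) (f : ell2 β) (a : α) :
    compOp g hg f a = f (g a) := rfl

theorem norm_compOp_le (g : α → β) (hg : Function.Injective g) : ‖compOp g hg‖ ≤ 1 :=
  LinearMap.mkContinuous_norm_le _ zero_le_one _

theorem compOp_adjoint_apply_self (g : α → β) (hg : Function.Injective g) (f : ell2 α) (a : α) :
    (compOp g hg).adjoint f (g a) = f a := by
  rw [← inner_ell2Single (g a), ContinuousLinearMap.adjoint_inner_right, ← inner_ell2Single a]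
  congr 1
  refine ell2_ext fun b => ?_
  rw [compOp_apply, ell2Single_apply, ell2Single_apply]
  by_cases hb : b = a
  · rw [if_pos hb, if_pos (congrArg g hb)]
  · rw [if_neg hb, if_neg (hg.ne hb)]

theorem compOp_adjoint_apply_of_forall_ne (g : α → β) (hg : Function.Injective g) (f : ell2 α)
    {b : β} (hb : ∀ a, g a ≠ b) : (compOp g hg).adjoint f b = 0 := by
  rw [← inner_ell2Single b, ContinuousLinearMap.adjoint_inner_right]
  have : compOp g hg (ell2Single b 1) = 0 := ell2_ext fun a => by
    simp [ell2Single_apply, hb a]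
  rw [this, inner_zero_left]

theorem compOp_comp_adjoint (g : α → β) (hg : Function.Injective g) :
    compOp g hg ∘L (compOp g hg).adjoint = ContinuousLinearMap.id ℂ (ell2 α) :=
  ContinuousLinearMap.ext fun f => ell2_ext fun a => compOp_adjoint_apply_self g hg f a

theorem restrictOp_adjoint_apply_mem (S : Set α) (f : ell2 S) {a : α} (h : a ∈ S) :
    (restrictOp S).adjoint f a = f ⟨a, h⟩ :=
  compOp_adjoint_apply_self Subtype.val Subtype.val_injective f ⟨a, h⟩

theorem restrictOp_adjoint_apply_notMem (S : Set α) (f : ell2 S) {a : α} (h : a ∉ S) :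
    (restrictOp S).adjoint f a = 0 :=
  compOp_adjoint_apply_of_forall_ne Subtype.val Subtype.val_injective f
    fun b hb => h (hb ▸ b.2)

theorem charOp_apply_mem (S : Set α) (f : ell2 α) {a : α} (h : a ∈ S) : charOp S f a = f a :=
  restrictOp_adjoint_apply_mem S (restrictOp S f) h

theorem charOp_apply_notMem (S : Set α) (f : ell2 α) {a : α} (h : a ∉ S) : charOp S f a = 0 :=
  restrictOp_adjoint_apply_notMem S (restrictOp S f) h

theorem norm_restrictOp_le (S : Set α) : ‖restrictOp S‖ ≤ 1 := norm_compOp_le _ _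

theorem norm_charOp_le (S : Set α) : ‖charOp S‖ ≤ 1 := by
  refine (ContinuousLinearMap.opNorm_comp_le _ _).trans ?_
  rw [LinearIsometryEquiv.norm_map]
  exact mul_le_one₀ (norm_restrictOp_le S) (norm_nonneg _) (norm_restrictOp_le S)

end Ell2

section Shift

variable {X : Type*} [AddCommGroup X]

theorem unilateralShift_apply_mem (E : Set X) (η : X) (f : ell2 E) (ξ : E)
    (h : (ξ : X) - η ∈ E) : unilateralShift E η f ξ = f ⟨ξ - η, h⟩ :=
  restrictOp_adjoint_apply_mem E f h

theorem unilateralShift_apply_notMem (E : Set X) (η : X) (f : ell2 E) (ξ : E)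
    (h : (ξ : X) - η ∉ E) : unilateralShift E η f ξ = 0 :=
  restrictOp_adjoint_apply_notMem E f h

theorem norm_unilateralShift_le (E : Set X) (η : X) : ‖unilateralShift E η‖ ≤ 1 := by
  refine (ContinuousLinearMap.opNorm_comp_le _ _).trans
    (mul_le_one₀ (norm_restrictOp_le E) (norm_nonneg _) ?_)
  refine (ContinuousLinearMap.opNorm_comp_le _ _).trans
    (mul_le_one₀ (norm_compOp_le _ _) (norm_nonneg _) ?_)
  rw [LinearIsometryEquiv.norm_map]
  exact norm_restrictOp_le E

theorem bilateralShift_adjoint (η : X) :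
    (bilateralShift η).adjoint = bilateralShift (-η) := by
  refine ContinuousLinearMap.ext fun f => ell2_ext fun ξ => ?_
  have h := compOp_adjoint_apply_self (fun ξ : X => ξ - η) (sub_left_injective (b := η)) f (ξ + η)
  simp only [add_sub_cancel_right] at h
  refine h.trans ?_
  simp [bilateralShift]

theorem unilateralShift_adjoint (E : Set X) (η : X) :
    (unilateralShift E η).adjoint = unilateralShift E (-η) := by
  simp only [unilateralShift, ContinuousLinearMap.adjoint_comp, bilateralShift_adjoint,
    ContinuousLinearMap.adjoint_adjoint, ContinuousLinearMap.comp_assoc]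

theorem norm_unilateralShift_comp_adjoint_le (E : Set X) (η : X) :
    ‖unilateralShift E η ∘L (unilateralShift E η).adjoint‖ ≤ 1 := by
  refine (ContinuousLinearMap.opNorm_comp_le _ _).trans ?_
  rw [LinearIsometryEquiv.norm_map]
  exact mul_le_one₀ (norm_unilateralShift_le E η) (norm_nonneg _) (norm_unilateralShift_le E η)

end Shift

theorem norm_smul_le_of_norm_le_one {V : Type*} [SeminormedAddCommGroup V] [NormedSpace ℂ V]
    (c : ℂ) {v : V} (h : ‖v‖ ≤ 1) : ‖c • v‖ ≤ ‖c‖ := by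
  rw [norm_smul]
  exact mul_le_of_le_one_right (norm_nonneg c) h

section Toeplitz

variable {X : Type*} [AddCommGroup X]

theorem summable_norm_toeplitz (E : Set X) {φ : X → ℂ} (hφ : Summable fun η => ‖φ η‖) :
    Summable fun η => ‖φ η • unilateralShift E η‖ :=
  hφ.of_nonneg_of_le (fun _ => norm_nonneg _)
    fun η => norm_smul_le_of_norm_le_one _ (norm_unilateralShift_le E η)

theorem summable_norm_potential (E : Set X) {ψ : X → ℂ} (hψ : Summable fun η => ‖ψ η‖) :
    Summable fun η => ‖ψ η • (unilateralShift E η ∘L (unilateralShift E η).adjoint)‖ :=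
  hψ.of_nonneg_of_le (fun _ => norm_nonneg _)
    fun η => norm_smul_le_of_norm_le_one _ (norm_unilateralShift_comp_adjoint_le E η)

theorem norm_toeplitzOp_le (E : Set X) {φ : X → ℂ} (hφ : Summable fun η => ‖φ η‖) :
    ‖toeplitzOp E φ‖ ≤ ∑' η, ‖φ η‖ :=
  tsum_of_norm_bounded hφ.hasSum
    fun η => norm_smul_le_of_norm_le_one _ (norm_unilateralShift_le E η)

theorem norm_potentialOp_le (E : Set X) {ψ : X → ℂ} (hψ : Summable fun η => ‖ψ η‖) :
    ‖potentialOp E ψ‖ ≤ ∑' η, ‖ψ η‖ :=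
  tsum_of_norm_bounded hψ.hasSum
    fun η => norm_smul_le_of_norm_le_one _ (norm_unilateralShift_comp_adjoint_le E η)

theorem isSelfAdjoint_toeplitzOp (E : Set X) {φ : X → ℂ} (hφ : ∀ η, φ (-η) = star (φ η)) :
    IsSelfAdjoint (toeplitzOp E φ) := by
  rw [isSelfAdjoint_iff, toeplitzOp, tsum_star, ← (Equiv.neg X).tsum_eq]
  refine tsum_congr fun η => ?_
  rw [Equiv.neg_apply, star_smul, hφ, star_star, ContinuousLinearMap.star_eq_adjoint,
    unilateralShift_adjoint, neg_neg]

theorem isSelfAdjoint_potentialOp (E : Set X) {ψ : X → ℂ} (hψ : ∀ η, star (ψ η) = ψ η) :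
    IsSelfAdjoint (potentialOp E ψ) := by
  rw [isSelfAdjoint_iff, potentialOp, tsum_star]
  refine tsum_congr fun η => ?_
  rw [star_smul, hψ, ContinuousLinearMap.star_eq_adjoint, ContinuousLinearMap.adjoint_comp,
    ContinuousLinearMap.adjoint_adjoint]

end Toeplitz

/-! ### Parseval's identity for vector valued Fourier series -/

section Parseval

open MeasureTheory AddCircle

variable {H : Type*} [NormedAddCommGroup H] [InnerProductSpace ℂ H]

/-- The Fourier series `τ ↦ ∑_z e^{-2πi z τ} g(z)` with coefficients in a Hilbert space. -/
def fourierSum (g : ℤ → H) (τ : UnitAddCircle) : H := ∑' z : ℤ, fourier (-z) τ • g z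

theorem norm_fourier_apply (n : ℤ) (τ : UnitAddCircle) : ‖fourier n τ‖ = 1 := by
  rw [fourier_apply]; exact Circle.norm_coe _

theorem norm_fourier_smul (n : ℤ) (τ : UnitAddCircle) (v : H) : ‖fourier n τ • v‖ = ‖v‖ := by
  rw [norm_smul, norm_fourier_apply, one_mul]

theorem summable_norm_fourier_smul {g : ℤ → H} (hg : Summable fun z => ‖g z‖)
    (τ : UnitAddCircle) : Summable fun z : ℤ => ‖fourier (-z) τ • g z‖ := by
  simpa only [norm_fourier_smul] using hg

theorem norm_fourierSum_le {g : ℤ → H} (hg : Summable fun z => ‖g z‖) (τ : UnitAddCircle) :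
    ‖fourierSum g τ‖ ≤ ∑' z, ‖g z‖ :=
  tsum_of_norm_bounded hg.hasSum fun _ => (norm_fourier_smul _ _ _).le

theorem continuous_fourierSum [CompleteSpace H] {g : ℤ → H} (hg : Summable fun z => ‖g z‖) :
    Continuous (fourierSum g) :=
  continuous_tsum (fun z => (fourier (-z)).continuous.smul continuous_const) hg
    fun _ _ => (norm_fourier_smul _ _ _).le

theorem integral_fourier (n : ℤ) :
    ∫ τ : UnitAddCircle, fourier n τ ∂haarAddCircle = if n = 0 then 1 else 0 := by
  have h := congrFun (fourierCoeff_fourier (T := 1) n) 0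
  simp only [fourierCoeff, neg_zero, fourier_zero, one_smul, Pi.single_apply] at h
  rw [h]
  simp only [eq_comm]

theorem integrable_of_continuous {E : Type*} [NormedAddCommGroup E] {f : UnitAddCircle → E}
    (hf : Continuous f) : Integrable f haarAddCircle :=
  hf.integrable_of_hasCompactSupport (HasCompactSupport.of_compactSpace f)

theorem integral_fourier_smul_fourierSum [CompleteSpace H] {g : ℤ → H}
    (hg : Summable fun z => ‖g z‖) (n : ℤ) :
    ∫ τ, fourier n τ • fourierSum g τ ∂haarAddCircle = g n := by
  have h1 : ∀ τ, fourier n τ • fourierSum g τ = ∑' z : ℤ, fourier (n + -z) τ • g z := by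
    intro τ
    rw [fourierSum, ← (summable_norm_fourier_smul hg τ).of_norm.tsum_const_smul]
    simp only [fourier_add, mul_smul]
  simp only [h1]
  rw [← integral_tsum_of_summable_integral_norm]
  · simp only [integral_smul_const, integral_fourier]
    rw [tsum_eq_single n]
    · simp
    · intro z hz
      rw [if_neg (by omega), zero_smul]
  · exact fun z => integrable_of_continuous ((fourier _).continuous.smul continuous_const)
  · simpa only [norm_fourier_smul, integral_const, probReal_univ, one_smul] using hg

/-- Parseval's identity for an absolutely convergent Fourier series with coefficients in a
Hilbert space. -/
theorem integral_norm_sq_fourierSum [CompleteSpace H] {g : ℤ → H}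
    (hg : Summable fun z => ‖g z‖) :
    ∫ τ, ‖fourierSum g τ‖ ^ 2 ∂haarAddCircle = ∑' z, ‖g z‖ ^ 2 := by
  have hc := continuous_fourierSum hg
  -- only one factor of `⟪G(τ), G(τ)⟫` is expanded; the coefficients of the other one are then
  -- recovered by integration
  have h1 : ∀ τ, ((‖fourierSum g τ‖ ^ 2 : ℝ) : ℂ)
      = ∑' z : ℤ, fourier z τ * inner ℂ (g z) (fourierSum g τ) := by
    intro τ
    have h2 := ((summable_norm_fourier_smul hg τ).of_norm.hasSum.mapL
      ((innerSLFlip ℂ) (fourierSum g τ) : H →L⋆[ℂ] ℂ)).tsum_eq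
    have h3 : (innerSLFlip ℂ) (fourierSum g τ) (∑' z : ℤ, fourier (-z) τ • g z)
      = ((‖fourierSum g τ‖ ^ 2 : ℝ) : ℂ) := by
      rw [innerSLFlip_apply_apply]
      push_cast
      exact inner_self_eq_norm_sq_to_K (𝕜 := ℂ) (fourierSum g τ)
    rw [h3] at h2
    rw [← h2]
    refine tsum_congr fun z => ?_
    rw [innerSLFlip_apply_apply, inner_smul_left, fourier_neg, Complex.conj_conj]
  have hint : ∀ z : ℤ, Continuous fun τ => fourier z τ * inner ℂ (g z) (fourierSum g τ) :=
    fun z => (fourier z).continuous.mul (continuous_const.inner hc)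
  apply Complex.ofReal_injective
  rw [← integral_complex_ofReal, Complex.ofReal_tsum]
  simp only [h1]
  rw [← integral_tsum_of_summable_integral_norm]
  · refine tsum_congr fun z => ?_
    have h4 : ∀ τ, fourier z τ * inner ℂ (g z) (fourierSum g τ)
        = inner ℂ (g z) (fourier z τ • fourierSum g τ) := fun τ => (inner_smul_right _ _ _).symm
    simp only [h4]
    erw [integral_inner (integrable_of_continuous ((fourier z).continuous.smul hc)),
      integral_fourier_smul_fourierSum hg]
    push_cast
    exact inner_self_eq_norm_sq_to_K (𝕜 := ℂ) (g z)
  · exact fun z => integrable_of_continuous (hint z)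
  · refine (hg.mul_right (∑' z, ‖g z‖)).of_nonneg_of_le
      (fun z => integral_nonneg fun τ => norm_nonneg _) fun z => ?_
    have h5 : ∀ τ, ‖fourier z τ * inner ℂ (g z) (fourierSum g τ)‖ ≤ ‖g z‖ * ∑' z, ‖g z‖ := by
      intro τ
      rw [norm_mul, norm_fourier_apply, one_mul]
      exact (norm_inner_le_norm _ _).trans
        (mul_le_mul_of_nonneg_left (norm_fourierSum_le hg τ) (norm_nonneg _))
    calc _ ≤ ∫ τ : UnitAddCircle, ‖g z‖ * ∑' z, ‖g z‖ ∂haarAddCircle :=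
          integral_mono (integrable_of_continuous (hint z).norm) (integrable_const _) h5
      _ = _ := by simp

/-- A pointwise comparison of absolutely convergent Fourier series gives a comparison of their
square sums. -/
theorem tsum_norm_sq_le_of_norm_fourierSum_le [CompleteSpace H] {g h : ℤ → H}
    (hg : Summable fun z => ‖g z‖) (hh : Summable fun z => ‖h z‖) {M : ℝ}
    (hM : ∀ τ, ‖fourierSum h τ‖ ≤ M * ‖fourierSum g τ‖) :
    ∑' z, ‖h z‖ ^ 2 ≤ M ^ 2 * ∑' z, ‖g z‖ ^ 2 := by
  rw [← integral_norm_sq_fourierSum hg, ← integral_norm_sq_fourierSum hh, ← integral_const_mul]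
  refine integral_mono (integrable_of_continuous ((continuous_fourierSum hh).norm.pow 2))
    (integrable_of_continuous (((continuous_fourierSum hg).norm.pow 2).const_mul _)) fun τ => ?_
  rw [← mul_pow]
  exact pow_le_pow_left₀ (norm_nonneg _) (hM τ) 2

end Parseval

/-! ### Decomposition of Toeplitz operators by a partial Fourier transform -/

/-- An identification of the pair `E ⊆ X` with `ℤ × F ⊆ ℤ × Y`: an isomorphism of groups
`ℤ × Y ≃ X` that carries `ℤ × F` onto `E`. -/
structure Layering {X Y : Type*} [AddCommGroup X] [AddCommGroup Y] (E : Set X) (F : Set Y) where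
  /-- the isomorphism of groups -/
  equiv : ℤ × Y ≃+ X
  mem_iff : ∀ z y, equiv (z, y) ∈ E ↔ y ∈ F

namespace Layering

variable {X Y : Type*} [AddCommGroup X] [AddCommGroup Y] {E : Set X} {F : Set Y}
  (D : Layering E F)

/-- The bijection `ℤ × F ≃ E` given by a layering. -/
def pointEquiv : ℤ × F ≃ E where
  toFun p := ⟨D.equiv (p.1, p.2), (D.mem_iff _ _).2 p.2.2⟩
  invFun x := ((D.equiv.symm x).1, ⟨(D.equiv.symm x).2, by
    rw [← D.mem_iff (D.equiv.symm x).1, Prod.mk.eta, AddEquiv.apply_symm_apply]; exact x.2⟩)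
  left_inv p := by simp
  right_inv x := by simp

/-- The restriction `f ↦ f(z, ·)` of a function on `E = ℤ × F` to the layer at height `z`. -/
def slice (z : ℤ) : ell2 E →L[ℂ] ell2 F :=
  compOp (fun w => D.pointEquiv (z, w)) fun w w' h => by
    simpa using D.pointEquiv.injective h

@[simp] theorem slice_apply (z : ℤ) (f : ell2 E) (w : F) :
    D.slice z f w = f (D.pointEquiv (z, w)) := rfl

theorem hasSum_norm_sq_slice (f : ell2 E) : HasSum (fun z => ‖D.slice z f‖ ^ 2) (‖f‖ ^ 2) :=
  (D.pointEquiv.hasSum_iff.2 (ell2_hasSum_norm_sq f)).prod_fiberwise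
    fun z => ell2_hasSum_norm_sq (D.slice z f)

theorem slice_unilateralShift (z k : ℤ) (y : Y) :
    D.slice z ∘L unilateralShift E (D.equiv (k, y))
      = unilateralShift F y ∘L D.slice (z - k) := by
  refine ContinuousLinearMap.ext fun f => ell2_ext fun w => ?_
  have key : ((D.pointEquiv (z, w) : E) : X) - D.equiv (k, y) = D.equiv (z - k, w - y) := by
    simp only [pointEquiv, Equiv.coe_fn_mk, ← map_sub, Prod.mk_sub_mk]
  change unilateralShift E _ f (D.pointEquiv (z, w)) = unilateralShift F y (D.slice (z - k) f) w
  by_cases hw : (w : Y) - y ∈ F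
  · have h1 : ((D.pointEquiv (z, w) : E) : X) - D.equiv (k, y) ∈ E := by
      rw [key]; exact (D.mem_iff _ _).2 hw
    rw [unilateralShift_apply_mem E _ f _ h1, unilateralShift_apply_mem F _ _ _ hw, slice_apply]
    congr 1
    exact Subtype.ext key
  · have h1 : ((D.pointEquiv (z, w) : E) : X) - D.equiv (k, y) ∉ E := by
      rw [key]; exact fun h => hw ((D.mem_iff _ _).1 h)
    rw [unilateralShift_apply_notMem E _ f _ h1, unilateralShift_apply_notMem F _ _ _ hw]

/-- The multiplication operators `v_η v_η^*` act within each layer, which is why only the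
frequency `0` enters the fibres of a potential. -/
theorem slice_unilateralShift_comp_adjoint (z k : ℤ) (y : Y) :
    D.slice z ∘L (unilateralShift E (D.equiv (k, y)) ∘L
        (unilateralShift E (D.equiv (k, y))).adjoint)
      = (unilateralShift F y ∘L (unilateralShift F y).adjoint) ∘L D.slice z := by
  rw [unilateralShift_adjoint, unilateralShift_adjoint, ← ContinuousLinearMap.comp_assoc,
    slice_unilateralShift, ContinuousLinearMap.comp_assoc, ← map_neg, Prod.neg_mk,
    slice_unilateralShift, ← ContinuousLinearMap.comp_assoc, sub_neg_eq_add, sub_add_cancel]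

/-- The operator `C` on `ℓ²(ℤ × F)` is decomposed by the Fourier transform in the first variable
into the operators `A τ` on `ℓ²(F)`. This is formulated on the dense invariant subspace of those
`f` for which the norms of the layers are summable, where the transform is given by an absolutely
convergent series. -/
def Decomposes (C : ell2 E →L[ℂ] ell2 E) (A : UnitAddCircle → ell2 F →L[ℂ] ell2 F) : Prop :=
  ∀ f, (Summable fun z => ‖D.slice z f‖) → (Summable fun z => ‖D.slice z (C f)‖) ∧
    ∀ τ, fourierSum (fun z => D.slice z (C f)) τ = A τ (fourierSum (fun z => D.slice z f) τ)

variable {D}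

theorem Decomposes.add {C C' : ell2 E →L[ℂ] ell2 E} {A A' : UnitAddCircle → ell2 F →L[ℂ] ell2 F}
    (h : D.Decomposes C A) (h' : D.Decomposes C' A') :
    D.Decomposes (C + C') fun τ => A τ + A' τ := by
  intro f hf
  obtain ⟨h1, h2⟩ := h f hf
  obtain ⟨h1', h2'⟩ := h' f hf
  refine ⟨(h1.add h1').of_nonneg_of_le (fun _ => norm_nonneg _) fun z => ?_, fun τ => ?_⟩
  · rw [add_apply, map_add]
    exact norm_add_le _ _
  · change _ = A τ _ + A' τ _
    rw [← h2, ← h2']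
    simp only [add_apply, map_add, fourierSum, smul_add]
    exact (summable_norm_fourier_smul h1 τ).of_norm.tsum_add
      (summable_norm_fourier_smul h1' τ).of_norm

theorem Decomposes.mul {C C' : ell2 E →L[ℂ] ell2 E} {A A' : UnitAddCircle → ell2 F →L[ℂ] ell2 F}
    (h : D.Decomposes C A) (h' : D.Decomposes C' A') :
    D.Decomposes (C * C') fun τ => A τ * A' τ := by
  intro f hf
  obtain ⟨h1', h2'⟩ := h' f hf
  obtain ⟨h1, h2⟩ := h _ h1'
  exact ⟨h1, fun τ => (h2 τ).trans (congrArg (A τ) (h2' τ))⟩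

theorem decomposes_algebraMap (D : Layering E F) (r : ℝ) :
    D.Decomposes (algebraMap ℝ _ r) fun _ => algebraMap ℝ _ r := by
  intro f hf
  have h : ∀ z, D.slice z ((algebraMap ℝ (ell2 E →L[ℂ] ell2 E) r) f) = (r : ℂ) • D.slice z f := by
    intro z
    rw [Algebra.algebraMap_eq_smul_one, ← Complex.coe_smul, smul_apply,
      one_apply_eq_self, map_smul]
  simp only [h]
  refine ⟨?_, fun τ => ?_⟩
  · simp only [norm_smul]
    exact hf.mul_left _
  · rw [Algebra.algebraMap_eq_smul_one, ← Complex.coe_smul, smul_apply,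
      one_apply_eq_self]
    simp only [fourierSum]
    rw [← (summable_norm_fourier_smul hf τ).of_norm.tsum_const_smul]
    exact tsum_congr fun z => smul_comm _ _ _

open Polynomial in
theorem Decomposes.aeval {C : ell2 E →L[ℂ] ell2 E} {A : UnitAddCircle → ell2 F →L[ℂ] ell2 F}
    (h : D.Decomposes C A) (p : ℝ[X]) :
    D.Decomposes (aeval C p) fun τ => aeval (A τ) p := by
  induction p using Polynomial.induction_on with
  | C r => simpa only [aeval_C] using decomposes_algebraMap D r
  | add p q hp hq => simpa only [map_add] using hp.add hq
  | monomial n r ih => simpa only [pow_succ, ← mul_assoc, map_mul, aeval_X] using ih.mul h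

/-- A norm convergent series of operators, each of which raises the height of the layers by a
fixed amount `k η`, is decomposed by the Fourier transform. -/
theorem decomposes_tsum {ι : Type*} (D : Layering E F) {c : ι → ℂ}
    (hc : Summable fun η => ‖c η‖) {C : ι → ell2 E →L[ℂ] ell2 E} {B : ι → ell2 F →L[ℂ] ell2 F}
    (hC : ∀ η, ‖C η‖ ≤ 1) (hB : ∀ η, ‖B η‖ ≤ 1) (k : ι → ℤ)
    (hCB : ∀ η z, D.slice z ∘L C η = B η ∘L D.slice (z - k η)) :
    D.Decomposes (∑' η, c η • C η) fun τ => ∑' η, (c η * fourier (-k η) τ) • B η := by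
  intro f hf
  -- `G η z` is the contribution of the term with index `η` to the layer at height `z`
  set G : ι → ℤ → ell2 F := fun η z => c η • B η (D.slice (z - k η) f) with hG
  have hGle : ∀ η z, ‖G η z‖ ≤ ‖c η‖ * ‖D.slice (z - k η) f‖ := fun η z => by
    rw [hG, norm_smul]
    exact mul_le_mul_of_nonneg_left ((B η).le_of_opNorm_le (hB η) _ |>.trans (one_mul _).le)
      (norm_nonneg _)
  have hGs : Summable fun q : ι × ℤ => ‖G q.1 q.2‖ := by
    have h1 := (hc.mul_of_nonneg hf (fun _ => norm_nonneg _) fun _ => norm_nonneg _).comp_injective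
      (i := fun q : ι × ℤ => (q.1, q.2 - k q.1)) (by
        rintro ⟨η, z⟩ ⟨η', z'⟩ h
        simp only [Prod.mk.injEq] at h
        obtain ⟨rfl, h⟩ := h
        rw [sub_left_inj.1 h])
    exact h1.of_nonneg_of_le (fun _ => norm_nonneg _) fun q => hGle q.1 q.2
  have hCs : Summable fun η => c η • C η :=
    Summable.of_norm_bounded hc fun η => norm_smul_le_of_norm_le_one _ (hC η)
  have hslice : ∀ z, D.slice z ((∑' η, c η • C η) f) = ∑' η, G η z := by
    intro z
    have h1 := ((hCs.hasSum.mapL (ContinuousLinearMap.apply ℂ (ell2 E) f)).mapL (D.slice z)).tsum_eq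
    rw [ContinuousLinearMap.apply_apply] at h1
    rw [← h1]
    refine tsum_congr fun η => ?_
    rw [ContinuousLinearMap.apply_apply, smul_apply, map_smul]
    exact congrArg (c η • ·) (DFunLike.congr_fun (hCB η z) f)
  have hGs' : Summable fun q : ℤ × ι => ‖G q.2 q.1‖ := hGs.prod_symm
  have hGη : ∀ z, Summable fun η => ‖G η z‖ := fun z => hGs'.prod_factor z
  have hGz : Summable fun z => ∑' η, ‖G η z‖ := hGs'.prod
  refine ⟨?_, fun τ => ?_⟩
  · simp only [hslice]
    exact hGz.of_nonneg_of_le (fun _ => norm_nonneg _)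
      fun z => norm_tsum_le_tsum_norm (hGη z)
  · have hBs : Summable fun η => (c η * fourier (-k η) τ) • B η := by
      refine Summable.of_norm_bounded hc fun η => ?_
      refine (norm_smul_le_of_norm_le_one _ (hB η)).trans ?_
      rw [norm_mul, norm_fourier_apply, mul_one]
    have h1 := (hBs.hasSum.mapL (ContinuousLinearMap.apply ℂ (ell2 F)
      (fourierSum (fun z => D.slice z f) τ))).tsum_eq
    rw [ContinuousLinearMap.apply_apply] at h1
    rw [← h1, fourierSum]
    have h2 : ∀ z, fourier (-z) τ • D.slice z ((∑' η, c η • C η) f)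
        = ∑' η, fourier (-z) τ • G η z := fun z => by
      rw [hslice, ← (hGη z).of_norm.tsum_const_smul]
    simp only [h2]
    rw [Summable.tsum_comm]
    · refine tsum_congr fun η => ?_
      rw [ContinuousLinearMap.apply_apply, smul_apply, fourierSum,
        ← ((summable_norm_fourier_smul hf τ).of_norm.hasSum.mapL (B η)).tsum_eq,
        ← ((summable_norm_fourier_smul hf τ).of_norm.mapL (B η)).tsum_const_smul,
        ← (Equiv.addRight (k η)).tsum_eq]
      refine tsum_congr fun z => ?_
      simp only [hG, Equiv.coe_addRight, add_sub_cancel_right, map_smul, smul_smul]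
      rw [mul_comm, mul_assoc, ← fourier_add, ← neg_add_rev]
    · refine Summable.of_norm ?_
      simpa only [Function.uncurry_def, norm_fourier_smul] using hGs

theorem summable_norm_slice_single (D : Layering E F) (x : E) (c : ℂ) :
    Summable fun z => ‖D.slice z (ell2Single x c)‖ := by
  refine summable_of_ne_finset_zero (s := {(D.pointEquiv.symm x).1}) fun z hz => ?_
  rw [norm_eq_zero]
  refine ell2_ext fun w => ?_
  rw [slice_apply, ell2Single_apply, if_neg, ell2_zero_apply]
  rintro rfl
  simp at hz

/-- By Parseval's identity an operator is bounded by the supremum of the norms of its fibres. -/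
theorem Decomposes.norm_le {C : ell2 E →L[ℂ] ell2 E} {A : UnitAddCircle → ell2 F →L[ℂ] ell2 F}
    (h : D.Decomposes C A) {M : ℝ} (hM : 0 ≤ M) (hA : ∀ τ, ‖A τ‖ ≤ M) : ‖C‖ ≤ M := by
  refine C.opNorm_le_bound hM fun f => ?_
  have hdense : ∀ g, (Summable fun z => ‖D.slice z g‖) → ‖C g‖ ≤ M * ‖g‖ := by
    intro g hg
    obtain ⟨h1, h2⟩ := h g hg
    have h3 := tsum_norm_sq_le_of_norm_fourierSum_le hg h1 (M := M) fun τ => by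
      rw [h2]; exact (A τ).le_of_opNorm_le (hA τ) _
    rw [(D.hasSum_norm_sq_slice g).tsum_eq, (D.hasSum_norm_sq_slice (C g)).tsum_eq,
      ← mul_pow] at h3
    exact (sq_le_sq₀ (norm_nonneg _) (by positivity)).1 h3
  -- finitely supported functions are dense
  have hlim := ell2_hasSum_single f
  refine le_of_tendsto_of_tendsto ((C.continuous.norm.tendsto f).comp hlim)
    ((tendsto_const_nhds.mul (continuous_norm.tendsto f)).comp hlim)
    (Filter.Eventually.of_forall fun s => hdense _ ?_)
  simp only [map_sum]
  exact (summable_sum fun x _ => D.summable_norm_slice_single x (f x)).of_nonneg_of_le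
    (fun _ => norm_nonneg _) fun z => norm_sum_le _ _

section PartialFourier

variable (D)

/-- The Fourier transform at `τ`, in the variable of the first factor, of a function on
`X ≃ ℤ × Y`. -/
def partialFourier (τ : UnitAddCircle) (ρ : X → ℂ) : Y → ℂ :=
  fun y => fourierZ (fun z => ρ (D.equiv (z, y))) τ

variable {ρ : X → ℂ}

theorem summable_norm_layers (hρ : Summable fun x => ‖ρ x‖) :
    Summable fun q : Y × ℤ => ‖ρ (D.equiv (q.2, q.1))‖ :=
  (D.equiv.toEquiv.summable_iff.2 hρ).prod_symm

theorem summable_norm_partialFourier (hρ : Summable fun x => ‖ρ x‖) (τ : UnitAddCircle) :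
    (Summable fun y => ‖D.partialFourier τ ρ y‖) ∧
      ∑' y, ‖D.partialFourier τ ρ y‖ ≤ ∑' x, ‖ρ x‖ := by
  have hs := D.summable_norm_layers hρ
  have hle : ∀ y, ‖D.partialFourier τ ρ y‖ ≤ ∑' z, ‖ρ (D.equiv (z, y))‖ := fun y =>
    norm_fourierSum_le (g := fun z => ρ (D.equiv (z, y))) (hs.prod_factor y) τ
  have h1 := hs.prod.of_nonneg_of_le (fun _ => norm_nonneg _) hle
  refine ⟨h1, (h1.tsum_le_tsum hle hs.prod).trans_eq ?_⟩
  rw [← hs.tsum_prod, ← D.equiv.toEquiv.tsum_eq, ← (Equiv.prodComm Y ℤ).tsum_eq]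
  rfl

theorem partialFourier_neg (hρ : ∀ x, ρ (-x) = star (ρ x)) (τ : UnitAddCircle) (y : Y) :
    D.partialFourier τ ρ (-y) = star (D.partialFourier τ ρ y) := by
  simp only [partialFourier, fourierZ]
  rw [tsum_star, ← (Equiv.neg ℤ).tsum_eq]
  refine tsum_congr fun z => ?_
  have h1 : D.equiv (-z, -y) = - D.equiv (z, y) := by rw [← map_neg, Prod.neg_mk]
  rw [Equiv.neg_apply, h1, hρ, star_mul', ← starRingEnd_apply, ← starRingEnd_apply, ← fourier_neg]

theorem star_partialFourier_zero (hρ : ∀ x, star (ρ x) = ρ x) (y : Y) :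
    star (D.partialFourier 0 ρ y) = D.partialFourier 0 ρ y := by
  simp only [partialFourier, fourierZ]
  rw [tsum_star]
  simp only [fourier_eval_zero, one_mul, hρ]

theorem tsum_mul_fourier_smul {V : Type*} [NormedAddCommGroup V] [NormedSpace ℂ V]
    [CompleteSpace V] (hρ : Summable fun x => ‖ρ x‖) (τ : UnitAddCircle) {B : Y → V}
    (hB : ∀ y, ‖B y‖ ≤ 1) :
    ∑' q : ℤ × Y, (ρ (D.equiv q) * fourier (-q.1) τ) • B q.2
      = ∑' y, D.partialFourier τ ρ y • B y := by
  have hs := D.summable_norm_layers hρ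
  have h1 : Summable fun q : Y × ℤ => (ρ (D.equiv (q.2, q.1)) * fourier (-q.2) τ) • B q.1 := by
    refine Summable.of_norm_bounded hs fun q => ?_
    refine (norm_smul_le_of_norm_le_one _ (hB q.1)).trans ?_
    rw [norm_mul, norm_fourier_apply, mul_one]
  rw [← (Equiv.prodComm Y ℤ).tsum_eq]
  refine h1.tsum_prod.trans (tsum_congr fun y => ?_)
  have h2 : Summable fun z : ℤ => fourier (-z) τ * ρ (D.equiv (z, y)) :=
    (summable_norm_fourier_smul (hs.prod_factor y) τ).of_norm
  rw [partialFourier, fourierZ, ← h2.tsum_smul_const]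
  exact tsum_congr fun z => by rw [mul_comm]

theorem decomposes_toeplitzOp (hρ : Summable fun x => ‖ρ x‖) :
    D.Decomposes (toeplitzOp E ρ) fun τ => toeplitzOp F (D.partialFourier τ ρ) := by
  have h := D.decomposes_tsum (D.equiv.toEquiv.summable_iff.2 hρ)
    (C := fun q => unilateralShift E (D.equiv q)) (B := fun q => unilateralShift F q.2)
    (fun _ => norm_unilateralShift_le _ _) (fun _ => norm_unilateralShift_le _ _)
    (fun q => q.1) fun q z => D.slice_unilateralShift z q.1 q.2
  convert h using 2
  · exact (D.equiv.toEquiv.tsum_eq (fun η => ρ η • unilateralShift E η)).symm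
  · exact (D.tsum_mul_fourier_smul hρ _ (norm_unilateralShift_le F)).symm

theorem decomposes_potentialOp (hρ : Summable fun x => ‖ρ x‖) :
    D.Decomposes (potentialOp E ρ) fun _ => potentialOp F (D.partialFourier 0 ρ) := by
  have h := D.decomposes_tsum (D.equiv.toEquiv.summable_iff.2 hρ)
    (C := fun q => unilateralShift E (D.equiv q) ∘L (unilateralShift E (D.equiv q)).adjoint)
    (B := fun q => unilateralShift F q.2 ∘L (unilateralShift F q.2).adjoint)
    (fun _ => norm_unilateralShift_comp_adjoint_le _ _)
    (fun _ => norm_unilateralShift_comp_adjoint_le _ _)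
    (fun _ => 0) fun q z => by
      rw [sub_zero]
      exact D.slice_unilateralShift_comp_adjoint z q.1 q.2
  convert h using 2
  · exact (D.equiv.toEquiv.tsum_eq
      (fun η => ρ η • (unilateralShift E η ∘L (unilateralShift E η).adjoint))).symm
  · refine (D.tsum_mul_fourier_smul hρ 0 (norm_unilateralShift_comp_adjoint_le F)).symm.trans
      (tsum_congr fun q => ?_)
    rw [fourier_eval_zero, neg_zero, fourier_zero]
    rfl

open Polynomial in
/-- Polynomials in `T_φ^E + V_ψ^E` are bounded in norm by the same polynomials in the fibre
operators on `ℓ²(F)`. -/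
theorem norm_aeval_le {φ ψ : X → ℂ} (hφ : Summable fun x => ‖φ x‖)
    (hψ : Summable fun x => ‖ψ x‖) (p : ℝ[X]) {M : ℝ} (hM : 0 ≤ M)
    (h : ∀ τ, ‖aeval (toeplitzOp F (D.partialFourier τ φ) +
      potentialOp F (D.partialFourier 0 ψ)) p‖ ≤ M) :
    ‖aeval (toeplitzOp E φ + potentialOp E ψ) p‖ ≤ M :=
  (((D.decomposes_toeplitzOp hφ).add (D.decomposes_potentialOp hψ)).aeval p).norm_le hM h

end PartialFourier

end Layering

/-! ### Comparison of operators far out -/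

section Localization

open Filter Topology

variable {α : Type*} {V W : Type*} [NormedAddCommGroup V] [NormedSpace ℂ V]
  [NormedAddCommGroup W] [NormedSpace ℂ W] {ℓ : α → ℤ}

/-- The region where the height function `ℓ` is at least `n`. -/
def farRegion (ℓ : α → ℤ) (n : ℕ) : Set α := {x | (n : ℤ) ≤ ℓ x}

/-- The operator `B` has small components far out, in the direction where `ℓ` tends to `∞`:
`‖χ_{ℓ ≥ n} B‖ → 0`. -/
def VanishesFar (ℓ : α → ℤ) (B : V →L[ℂ] ell2 α) : Prop :=
  Tendsto (fun n : ℕ => charOp (farRegion ℓ n) ∘L B) atTop (𝓝 0)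

theorem VanishesFar.add {B C : V →L[ℂ] ell2 α} (hB : VanishesFar ℓ B) (hC : VanishesFar ℓ C) :
    VanishesFar ℓ (B + C) := by
  simpa only [VanishesFar, ContinuousLinearMap.comp_add, add_zero] using Tendsto.add hB hC

theorem VanishesFar.comp {B : V →L[ℂ] ell2 α} (hB : VanishesFar ℓ B) (C : W →L[ℂ] V) :
    VanishesFar ℓ (B ∘L C) := by
  have h := (((ContinuousLinearMap.compL ℂ W V (ell2 α)).flip C).continuous.tendsto 0).comp hB
  rw [map_zero] at h
  exact h

theorem vanishesFar_of_apply_eq_zero {B : V →L[ℂ] ell2 α} (N : ℤ)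
    (h : ∀ f x, N ≤ ℓ x → B f x = 0) : VanishesFar ℓ B := by
  refine tendsto_const_nhds.congr' ?_
  filter_upwards [eventually_ge_atTop N.toNat] with n hn
  refine ContinuousLinearMap.ext fun f => ell2_ext fun x => ?_
  change 0 = charOp (farRegion ℓ n) (B f) x
  by_cases hx : x ∈ farRegion ℓ n
  · have hx' : (n : ℤ) ≤ ℓ x := hx
    rw [charOp_apply_mem _ _ hx, h f x (by omega)]
  · rw [charOp_apply_notMem _ _ hx]

theorem VanishesFar.hasSum {ι : Type*} {B : ι → V →L[ℂ] ell2 α} {S : V →L[ℂ] ell2 α}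
    (hB : ∀ i, VanishesFar ℓ (B i)) (hs : Summable fun i => ‖B i‖) (hS : HasSum B S) :
    VanishesFar ℓ S := by
  have h1 : ∀ n : ℕ, charOp (farRegion ℓ n) ∘L S
      = ∑' i, charOp (farRegion ℓ n) ∘L B i := fun n =>
    (hS.mapL (ContinuousLinearMap.compL ℂ V (ell2 α) (ell2 α)
      (charOp (farRegion ℓ n)))).tsum_eq.symm
  have h2 := tendsto_tsum_of_dominated_convergence (𝓕 := atTop) hs hB
    (Eventually.of_forall fun n i => (ContinuousLinearMap.opNorm_comp_le _ _).trans
      (mul_le_of_le_one_left (norm_nonneg (B i)) (norm_charOp_le _)))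
  rw [tsum_zero] at h2
  simpa only [VanishesFar, h1] using h2

/-- The operator `A` hardly moves mass from a region where `ℓ` is bounded above to the region
where `ℓ` is large. -/
def IsLocal (ℓ : α → ℤ) (A : ell2 α →L[ℂ] ell2 α) : Prop :=
  ∀ k : ℕ, VanishesFar ℓ (A ∘L (1 - charOp (farRegion ℓ k)))

/-- Locality of `A` is what makes `A B` vanish far out together with `B`: cutting `B` at a large
fixed height `k`, the part above `k` is small and `A` hardly moves the part below `k` far out. -/
theorem IsLocal.comp {A : ell2 α →L[ℂ] ell2 α} (hA : IsLocal ℓ A) {B : V →L[ℂ] ell2 α}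
    (hB : VanishesFar ℓ B) : VanishesFar ℓ (A ∘L B) := by
  have hB' := (tendsto_zero_iff_norm_tendsto_zero.1 hB).const_mul ‖A‖
  rw [mul_zero] at hB'
  refine tendsto_zero_iff_norm_tendsto_zero.2 (tendsto_order.2 ⟨fun a ha =>
    Eventually.of_forall fun n => ha.trans_le (norm_nonneg _), fun ε hε => ?_⟩)
  obtain ⟨k, hk⟩ := (hB'.eventually_lt_const (half_pos hε)).exists
  have hA' := tendsto_zero_iff_norm_tendsto_zero.1 ((hA k).comp B)
  filter_upwards [hA'.eventually_lt_const (half_pos hε)] with n hn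
  have hsplit : charOp (farRegion ℓ n) ∘L (A ∘L B)
      = charOp (farRegion ℓ n) ∘L ((A ∘L (1 - charOp (farRegion ℓ k))) ∘L B)
        + charOp (farRegion ℓ n) ∘L (A ∘L (charOp (farRegion ℓ k) ∘L B)) := by
    refine ContinuousLinearMap.ext fun f => ?_
    simp
  have h3 : ‖charOp (farRegion ℓ n) ∘L (A ∘L (charOp (farRegion ℓ k) ∘L B))‖
      ≤ ‖A‖ * ‖charOp (farRegion ℓ k) ∘L B‖ :=
    ((ContinuousLinearMap.opNorm_comp_le _ _).trans
      (mul_le_of_le_one_left (norm_nonneg _) (norm_charOp_le _))).trans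
      (ContinuousLinearMap.opNorm_comp_le _ _)
  rw [hsplit]
  exact (norm_add_le _ _).trans_lt (by linarith)

/-- The operator `A` on `ℓ²(α)` is local, and far out, where `ℓ` is large, it acts like the
operator `A'` on the space `V`, the two spaces being compared by `r : V → ℓ²(α)`. -/
structure AgreesFar (ℓ : α → ℤ) (r : V →L[ℂ] ell2 α) (A : ell2 α →L[ℂ] ell2 α)
    (A' : V →L[ℂ] V) : Prop where
  isLocal : IsLocal ℓ A
  vanishesFar : VanishesFar ℓ (A ∘L r - r ∘L A')

namespace AgreesFar

variable {r : V →L[ℂ] ell2 α} {A B : ell2 α →L[ℂ] ell2 α} {A' B' : V →L[ℂ] V}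

theorem add (hA : AgreesFar ℓ r A A') (hB : AgreesFar ℓ r B B') :
    AgreesFar ℓ r (A + B) (A' + B') where
  isLocal k := by
    rw [ContinuousLinearMap.add_comp]
    exact (hA.isLocal k).add (hB.isLocal k)
  vanishesFar := by
    rw [ContinuousLinearMap.add_comp, ContinuousLinearMap.comp_add, add_sub_add_comm]
    exact hA.vanishesFar.add hB.vanishesFar

theorem mul (hA : AgreesFar ℓ r A A') (hB : AgreesFar ℓ r B B') :
    AgreesFar ℓ r (A * B) (A' * B') where
  isLocal k := by
    rw [ContinuousLinearMap.mul_def, ContinuousLinearMap.comp_assoc]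
    exact hA.isLocal.comp (hB.isLocal k)
  vanishesFar := by
    have h : (A * B) ∘L r - r ∘L (A' * B')
        = A ∘L (B ∘L r - r ∘L B') + (A ∘L r - r ∘L A') ∘L B' := by
      refine ContinuousLinearMap.ext fun f => ?_
      simp
    rw [h]
    exact (hA.isLocal.comp hB.vanishesFar).add (hA.vanishesFar.comp B')

theorem of_algebraMap (ℓ : α → ℤ) (r : V →L[ℂ] ell2 α) (c : ℝ) :
    AgreesFar ℓ r (algebraMap ℝ _ c) (algebraMap ℝ _ c) where
  isLocal k := vanishesFar_of_apply_eq_zero k fun f x hx => by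
    rw [Algebra.algebraMap_eq_smul_one, ← Complex.coe_smul]
    change (c : ℂ) * (f x - charOp (farRegion ℓ k) f x) = 0
    rw [charOp_apply_mem (farRegion ℓ k) _ hx, sub_self, mul_zero]
  vanishesFar := by
    have h : (algebraMap ℝ (ell2 α →L[ℂ] ell2 α) c) ∘L r
        - r ∘L (algebraMap ℝ (V →L[ℂ] V) c) = 0 := by
      refine ContinuousLinearMap.ext fun f => ?_
      simp [Algebra.algebraMap_eq_smul_one, ← Complex.coe_smul]
    rw [h]
    exact vanishesFar_of_apply_eq_zero 0 fun f x _ => rfl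

open Polynomial in
theorem aeval (h : AgreesFar ℓ r A A') (p : ℝ[X]) :
    AgreesFar ℓ r (aeval A p) (aeval A' p) := by
  induction p using Polynomial.induction_on with
  | C c => simpa only [aeval_C] using AgreesFar.of_algebraMap ℓ r c
  | add p q hp hq => simpa only [map_add] using hp.add hq
  | monomial n c ih => simpa only [pow_succ, ← mul_assoc, map_mul, aeval_X] using ih.mul h

theorem smul (h : AgreesFar ℓ r A A') (c : ℂ) : AgreesFar ℓ r (c • A) (c • A') where
  isLocal k := by
    have h1 : (c • A) ∘L (1 - charOp (farRegion ℓ k))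
        = (A ∘L (1 - charOp (farRegion ℓ k))) ∘L (c • 1) := by
      refine ContinuousLinearMap.ext fun f => ?_
      simp [smul_sub]
    rw [h1]
    exact (h.isLocal k).comp _
  vanishesFar := by
    have h1 : (c • A) ∘L r - r ∘L (c • A') = (A ∘L r - r ∘L A') ∘L (c • 1) := by
      refine ContinuousLinearMap.ext fun f => ?_
      simp [smul_sub]
    rw [h1]
    exact h.vanishesFar.comp _

theorem tsum [CompleteSpace V] {ι : Type*} {C : ι → ell2 α →L[ℂ] ell2 α} {C' : ι → V →L[ℂ] V}
    (h : ∀ i, AgreesFar ℓ r (C i) (C' i)) (hC : Summable fun i => ‖C i‖)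
    (hC' : Summable fun i => ‖C' i‖) : AgreesFar ℓ r (∑' i, C i) (∑' i, C' i) where
  isLocal k := by
    refine VanishesFar.hasSum (fun i => (h i).isLocal k) ?_ (hC.of_norm.hasSum.mapL
      ((ContinuousLinearMap.compL ℂ (ell2 α) (ell2 α) (ell2 α)).flip _))
    exact (hC.mul_right _).of_nonneg_of_le (fun _ => norm_nonneg _)
      fun i => ContinuousLinearMap.opNorm_comp_le _ _
  vanishesFar := by
    refine VanishesFar.hasSum (fun i => (h i).vanishesFar) ?_ ((hC.of_norm.hasSum.mapL
      ((ContinuousLinearMap.compL ℂ V (ell2 α) (ell2 α)).flip r)).sub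
      (hC'.of_norm.hasSum.mapL (ContinuousLinearMap.compL ℂ V V (ell2 α) r)))
    exact ((hC.mul_right ‖r‖).add (hC'.mul_left ‖r‖)).of_nonneg_of_le (fun _ => norm_nonneg _)
      fun i => (norm_sub_le _ _).trans (add_le_add (ContinuousLinearMap.opNorm_comp_le _ _)
        (ContinuousLinearMap.opNorm_comp_le _ _))

end AgreesFar

section Subset

variable {X : Type*} {E E' : Set X}

/-- The restriction `ℓ²(E') → ℓ²(E)` for subsets `E ⊆ E'` of `X`. -/
def restrictSubset (hEE' : E ⊆ E') : ell2 E' →L[ℂ] ell2 E :=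
  compOp (Set.inclusion hEE') (Set.inclusion_injective hEE')

/-- If `Q` agrees far out with an operator `Q'` of small norm, then every operator `K` close to `Q`
is small far out. -/
theorem AgreesFar.eventually_norm_charOp_comp_le {K Q : ell2 E →L[ℂ] ell2 E}
    {Q' : ell2 E' →L[ℂ] ell2 E'} {ℓ : E → ℤ} (hEE' : E ⊆ E')
    (h : AgreesFar ℓ (restrictSubset hEE') Q Q') {δ : ℝ} (hδ : 0 < δ) (hQ' : ‖Q'‖ ≤ δ)
    (hK : ‖K - Q‖ ≤ δ) :
    ∀ᶠ n : ℕ in atTop, ‖charOp (farRegion ℓ n) ∘L K‖ ≤ 3 * δ := by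
  set r := restrictSubset hEE'
  have hr : ‖r‖ ≤ 1 := norm_compOp_le _ _
  have hr' : ‖r.adjoint‖ ≤ 1 := (LinearIsometryEquiv.norm_map _ _).trans_le hr
  have hrr : ∀ f, r (r.adjoint f) = f :=
    fun f => DFunLike.congr_fun (compOp_comp_adjoint _ (Set.inclusion_injective hEE')) f
  filter_upwards [(tendsto_zero_iff_norm_tendsto_zero.1
    (h.vanishesFar.comp r.adjoint)).eventually_lt_const hδ] with n hn
  -- `r r* = 1` on `ℓ²(E)`, so `Q = (Q r - r Q') r* + r Q' r*`
  set χ := charOp (farRegion ℓ n)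
  have hχ : ‖χ‖ ≤ 1 := norm_charOp_le _
  have hsplit : χ ∘L K = χ ∘L (K - Q) + χ ∘L ((Q ∘L r - r ∘L Q') ∘L r.adjoint)
      + χ ∘L (r ∘L (Q' ∘L r.adjoint)) := by
    refine ContinuousLinearMap.ext fun f => ?_
    simp [hrr]
  have h1 : ‖χ ∘L (K - Q)‖ ≤ δ := ((ContinuousLinearMap.opNorm_comp_le _ _).trans
      (mul_le_of_le_one_left (norm_nonneg _) hχ)).trans hK
  have h2 : ‖χ ∘L (r ∘L (Q' ∘L r.adjoint))‖ ≤ δ :=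
    (((ContinuousLinearMap.opNorm_comp_le _ _).trans
      (mul_le_of_le_one_left (norm_nonneg _) hχ)).trans
      ((ContinuousLinearMap.opNorm_comp_le _ _).trans
      (mul_le_of_le_one_left (norm_nonneg _) hr))).trans
      (((ContinuousLinearMap.opNorm_comp_le _ _).trans
      (mul_le_of_le_one_right (norm_nonneg _) hr')).trans hQ')
  rw [hsplit]
  refine (norm_add₃_le).trans ?_
  linarith

end Subset

section Shift

variable {X : Type*} [AddCommGroup X] {E E' : Set X} {L : X →+ ℤ}

/-- Where `L` is large, the shifts on `ℓ²(E)` and on `ℓ²(E')` are the same, since `E` is cut out of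
`E'` by the condition `L ≥ 1`. -/
theorem agreesFar_unilateralShift (hEE' : E ⊆ E') (hL : ∀ x ∈ E', 1 ≤ L x → x ∈ E) (η : X) :
    AgreesFar (fun x : E => L x) (restrictSubset hEE')
      (unilateralShift E η) (unilateralShift E' η) where
  isLocal k := vanishesFar_of_apply_eq_zero (k + L η) fun f x hx => by
    change unilateralShift E η (f - charOp (farRegion (fun x : E => L x) k) f) x = 0
    by_cases h : (x : X) - η ∈ E
    · rw [unilateralShift_apply_mem E η _ x h, ell2_sub_apply, charOp_apply_mem, sub_self]
      change (k : ℤ) ≤ L (x - η)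
      rw [map_sub]
      omega
    · exact unilateralShift_apply_notMem E η _ x h
  vanishesFar := vanishesFar_of_apply_eq_zero (1 + L η) fun f x hx => by
    change unilateralShift E η (restrictSubset hEE' f) x
      - unilateralShift E' η f (Set.inclusion hEE' x) = 0
    by_cases h : (x : X) - η ∈ E
    · rw [unilateralShift_apply_mem E η _ x h, unilateralShift_apply_mem E' η _ _ (hEE' h)]
      exact sub_self _
    · rw [unilateralShift_apply_notMem E η _ x h, unilateralShift_apply_notMem E' η, sub_zero]
      refine fun h' => h (hL _ h' ?_)
      rw [map_sub]
      omega

theorem agreesFar_toeplitzOp_add_potentialOp (hEE' : E ⊆ E')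
    (hL : ∀ x ∈ E', 1 ≤ L x → x ∈ E) {φ ψ : X → ℂ} (hφ : Summable fun x => ‖φ x‖)
    (hψ : Summable fun x => ‖ψ x‖) :
    AgreesFar (fun x : E => L x) (restrictSubset hEE')
      (toeplitzOp E φ + potentialOp E ψ) (toeplitzOp E' φ + potentialOp E' ψ) := by
  refine (AgreesFar.tsum (fun η => ?_) (summable_norm_toeplitz E hφ)
    (summable_norm_toeplitz E' hφ)).add (AgreesFar.tsum (fun η => ?_)
    (summable_norm_potential E hψ) (summable_norm_potential E' hψ))
  · exact (agreesFar_unilateralShift hEE' hL η).smul _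
  · rw [unilateralShift_adjoint, unilateralShift_adjoint]
    exact ((agreesFar_unilateralShift hEE' hL η).mul
      (agreesFar_unilateralShift hEE' hL (-η))).smul _

end Shift

end Localization

/-! ### The cone of increasing tuples -/

section Cone

theorem thetaInv_cons_zero {m : ℕ} (t : ℤ) (z : Fin m → ℤ) :
    thetaInv (Fin.cons t z : Fin (m + 1) → ℤ) 0 = t := by
  have : Finset.Iic (0 : Fin (m + 1)) = {0} := by ext k; simp
  rw [thetaInv, this, Finset.sum_singleton, Fin.cons_zero]

theorem thetaInv_cons_succ {m : ℕ} (t : ℤ) (z : Fin m → ℤ) (k : Fin m) :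
    thetaInv (Fin.cons t z : Fin (m + 1) → ℤ) k.succ
      = thetaInv (Fin.cons t z : Fin (m + 1) → ℤ) k.castSucc + z k := by
  have h : Finset.Iic k.succ = insert k.succ (Finset.Iic k.castSucc) := by
    ext j
    simp only [Finset.mem_Iic, Finset.mem_insert, Fin.le_def, Fin.ext_iff, Fin.val_succ,
      Fin.val_castSucc]
    omega
  have h' : k.succ ∉ Finset.Iic k.castSucc := by
    simp [Fin.le_def]
  rw [thetaInv, h, Finset.sum_insert h', Fin.cons_succ, add_comm]
  rfl

/-- The change of variables `θ⁻¹`, with the first variable split off, as an isomorphism of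
groups. -/
def thetaInvEquiv (m : ℕ) : ℤ × (Fin m → ℤ) ≃+ (Fin (m + 1) → ℤ) where
  toFun p := thetaInv (Fin.cons p.1 p.2)
  invFun y := (y 0, fun k => y k.succ - y k.castSucc)
  left_inv p := by
    simp only [thetaInv_cons_zero, thetaInv_cons_succ, add_sub_cancel_left]
  right_inv y := by
    change thetaInv (Fin.cons (y 0) fun k => y k.succ - y k.castSucc) = y
    funext k
    induction k using Fin.induction with
    | zero => rw [thetaInv_cons_zero]
    | succ k ih => rw [thetaInv_cons_succ, ih, add_sub_cancel]
  map_add' p q := by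
    funext k
    induction k using Fin.induction with
    | zero => simp only [Pi.add_apply, thetaInv_cons_zero, Prod.fst_add]
    | succ k ih =>
      rw [Pi.add_apply] at ih ⊢
      rw [thetaInv_cons_succ, thetaInv_cons_succ, thetaInv_cons_succ, ih, Prod.snd_add,
        Pi.add_apply]
      ring

/-- Insertion of a variable at position `i`, as an isomorphism of groups. -/
def insertNthAddEquiv {m : ℕ} (i : Fin (m + 1)) : ℤ × (Fin m → ℤ) ≃+ (Fin (m + 1) → ℤ) where
  toFun p := i.insertNth p.1 p.2
  invFun y := (y i, fun k => y (i.succAbove k))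
  left_inv p := by simp
  right_inv y := by
    funext k
    induction k using i.succAboveCases <;> simp
  map_add' p q := by
    funext k
    induction k using i.succAboveCases <;> simp

/-- The tuples that increase at every step except possibly the one from position `i` to position
`i + 1`. -/
def increasingTuplesExcept {m : ℕ} (i : Fin (m + 1)) : Set (Fin (m + 2) → ℤ) :=
  {y | ∀ k, k ≠ i → y k.castSucc < y k.succ}

/-- The tuples whose components are positive, except possibly the one at position `i`. -/
def positiveTuplesExcept {m : ℕ} (i : Fin (m + 1)) : Set (Fin (m + 1) → ℤ) :=
  {z | ∀ k, k ≠ i → 1 ≤ z k}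

/-- The layering of `increasingTuplesExcept i` given by the change of variables `θ⁻¹`. Its partial
Fourier transform is `mu` by definition. -/
def thetaLayering {m : ℕ} (i : Fin (m + 1)) :
    Layering (increasingTuplesExcept i) (positiveTuplesExcept i) where
  equiv := thetaInvEquiv (m + 1)
  mem_iff t z := by
    refine forall₂_congr fun k _ => ?_
    change thetaInv (Fin.cons t z) k.castSucc < thetaInv (Fin.cons t z) k.succ ↔ _
    rw [thetaInv_cons_succ]
    omega

/-- The layering of `positiveTuplesExcept i` by the unconstrained variable. Its partial Fourier
transform is `nu i` by definition. -/
def insertLayering {m : ℕ} (i : Fin (m + 1)) :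
    Layering (positiveTuplesExcept i) (positiveTuples m) where
  equiv := insertNthAddEquiv i
  mem_iff t w := by
    change (∀ k, k ≠ i → 1 ≤ (i.insertNth t w : Fin (m + 1) → ℤ) k) ↔ ∀ k, 1 ≤ w k
    constructor
    · intro h k
      simpa using h _ (i.succAbove_ne k)
    · intro h k hk
      obtain ⟨j, rfl⟩ := Fin.exists_succAbove_eq hk
      simpa using h j

/-- The step `y ↦ y_{i+1} - y_i` as a homomorphism. -/
def stepHom {m : ℕ} (i : Fin (m + 1)) : (Fin (m + 2) → ℤ) →+ ℤ where
  toFun y := y i.succ - y i.castSucc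
  map_zero' := by simp
  map_add' x y := by simp only [Pi.add_apply]; ring

theorem increasingTuples_subset {m : ℕ} (i : Fin (m + 1)) :
    increasingTuples (m + 2) ⊆ increasingTuplesExcept i :=
  fun _ hy _ _ => hy Fin.castSucc_lt_succ

theorem mem_increasingTuples_of_stepHom {m : ℕ} (i : Fin (m + 1)) :
    ∀ y ∈ increasingTuplesExcept i, 1 ≤ stepHom i y → y ∈ increasingTuples (m + 2) := by
  intro y hy h
  refine Fin.strictMono_iff_lt_succ.2 fun k => ?_
  by_cases hk : k = i
  · subst hk
    change 1 ≤ y k.succ - y k.castSucc at h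
    omega
  · exact hy k hk

end Cone

/-! ### Polynomial approximation of the functional calculus -/

section FunctionalCalculus

open Polynomial

theorem norm_cfc_sub_aeval_le {α : Type*} {A : ell2 α →L[ℂ] ell2 α} (hA : IsSelfAdjoint A)
    {R : ℝ} (hR : ‖A‖ ≤ R) {κ : ℝ → ℝ} (hκ : Continuous κ) {p : ℝ[X]} {δ : ℝ} (hδ : 0 ≤ δ)
    (hp : ∀ x ∈ Set.Icc (-R) R, |p.eval x - κ x| < δ) : ‖cfc κ A - aeval A p‖ ≤ δ := by
  have h1 : cfc κ A - aeval A p = cfc (fun x => κ x - p.eval x) A := by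
    rw [cfc_sub (a := A) κ (fun x => p.eval x) hκ.continuousOn p.continuous.continuousOn]
    congr 1
    exact (cfc_polynomial p A hA).symm
  rw [h1]
  refine norm_cfc_le hδ fun x hx => ?_
  rw [Real.norm_eq_abs, abs_sub_comm]
  refine (hp x (abs_le.1 ?_)).le
  calc |x| ≤ ‖A‖ * ‖(1 : ell2 α →L[ℂ] ell2 α)‖ := spectrum.norm_le_norm_mul_of_mem hx
    _ ≤ ‖A‖ := mul_le_of_le_one_right (norm_nonneg _) ContinuousLinearMap.norm_id_le
    _ ≤ R := hR

/-- Here `κ(A) = 0`, because `κ` vanishes on the spectrum of `A`. -/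
theorem norm_aeval_le_of_disjoint_spectrum {α : Type*} {A : ell2 α →L[ℂ] ell2 α}
    (hA : IsSelfAdjoint A) {R : ℝ} (hR : ‖A‖ ≤ R) {κ : ℝ → ℝ} (hκ : Continuous κ)
    (hs : Disjoint ((fun t : ℝ => (t : ℂ)) '' tsupport κ) (spectrum ℂ A)) {p : ℝ[X]} {δ : ℝ}
    (hδ : 0 ≤ δ) (hp : ∀ x ∈ Set.Icc (-R) R, |p.eval x - κ x| < δ) : ‖aeval A p‖ ≤ δ := by
  have h0 : cfc κ A = 0 := by
    rw [← cfc_zero ℝ A]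
    refine cfc_congr fun x hx => image_eq_zero_of_notMem_tsupport fun hxt => ?_
    have hx' : (x : ℂ) ∈ spectrum ℂ A := (spectrum.algebraMap_mem_iff (R := ℝ) ℂ (a := A)).2 hx
    exact Set.disjoint_left.1 hs ⟨x, hxt, rfl⟩ hx'
  simpa only [h0, zero_sub, norm_neg] using norm_cfc_sub_aeval_le hA hR hκ hδ hp

end FunctionalCalculus

end ToeplitzLattice

end

open ToeplitzLattice in
/-- Here `N = m + 2` and `j = i + 2`, so that `i = 0, …, m` corresponds to `j = 2, …, N`.
The symmetry of `φ` is what makes `T_φ^< + V_ψ^<` self-adjoint; `cfc κ` is the continuous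
functional calculus `κ(T_φ^< + V_ψ^<)`. -/
theorem theorem5p1 (m : ℕ) (i : Fin (m + 1)) (φ ψ : (Fin (m + 2) → ℤ) → ℝ)
    (hφ : Summable fun η => |φ η|) (hψ : Summable fun η => |ψ η|)
    (hφ_symm : ∀ η, φ (-η) = φ η)
    (κ : ℝ → ℝ) (hκ : Continuous κ)
    (hsupp : Disjoint ((fun t : ℝ => (t : ℂ)) '' tsupport κ)
      (⋃ (τ : UnitAddCircle) (τ' : UnitAddCircle),
        SigmaSet i (fun η => (φ η : ℂ)) (fun η => (ψ η : ℂ)) τ τ')) :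
    ∀ ε : ℝ, 0 < ε → ∃ n₀ : ℕ, ∀ n : ℕ, n₀ ≤ n →
      ‖charOp (Omega i n) ∘L
        cfc κ (hamiltonian (m + 2) (fun η => (φ η : ℂ)) (fun η => (ψ η : ℂ)))‖ ≤ ε := by
  intro ε hε
  set Φ : (Fin (m + 2) → ℤ) → ℂ := fun η => (φ η : ℂ) with hΦ
  set Ψ : (Fin (m + 2) → ℤ) → ℂ := fun η => (ψ η : ℂ) with hΨ
  have hΦs : Summable fun η => ‖Φ η‖ := by simpa [hΦ] using hφ
  have hΨs : Summable fun η => ‖Ψ η‖ := by simpa [hΨ] using hψ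
  have hΦ_symm : ∀ η, Φ (-η) = star (Φ η) := fun η => by simp [hΦ, hφ_symm]
  have hΨ_real : ∀ η, star (Ψ η) = Ψ η := fun η => by simp [hΨ]
  -- `R` bounds the norms of the Hamiltonian and of all fibre operators
  set R : ℝ := ∑' η, ‖Φ η‖ + ∑' η, ‖Ψ η‖
  have hδ : 0 < ε / 3 := by positivity
  obtain ⟨p, hp⟩ := exists_polynomial_near_of_continuousOn (-R) R κ hκ.continuousOn (ε / 3) hδ
  have hfar := (agreesFar_toeplitzOp_add_potentialOp (increasingTuples_subset i)
    (mem_increasingTuples_of_stepHom i) hΦs hΨs).aeval p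
  have hlimit : ‖Polynomial.aeval (toeplitzOp (increasingTuplesExcept i) Φ +
      potentialOp (increasingTuplesExcept i) Ψ) p‖ ≤ ε / 3 := by
    obtain ⟨hΨ₁, hΨ₁_le⟩ := (thetaLayering i).summable_norm_partialFourier hΨs 0
    obtain ⟨hΨ₂, hΨ₂_le⟩ := (insertLayering i).summable_norm_partialFourier hΨ₁ 0
    refine (thetaLayering i).norm_aeval_le hΦs hΨs p hδ.le fun τ => ?_
    obtain ⟨hΦ₁, hΦ₁_le⟩ := (thetaLayering i).summable_norm_partialFourier hΦs τ
    refine (insertLayering i).norm_aeval_le hΦ₁ hΨ₁ p hδ.le fun τ' => ?_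
    obtain ⟨hΦ₂, hΦ₂_le⟩ := (insertLayering i).summable_norm_partialFourier hΦ₁ τ'
    refine norm_aeval_le_of_disjoint_spectrum ?_ ?_ hκ ?_ hδ.le hp
    · exact (isSelfAdjoint_toeplitzOp _ ((insertLayering i).partialFourier_neg
        ((thetaLayering i).partialFourier_neg hΦ_symm τ) τ')).add
        (isSelfAdjoint_potentialOp _ ((insertLayering i).star_partialFourier_zero
        ((thetaLayering i).star_partialFourier_zero hΨ_real)))
    · exact (norm_add_le _ _).trans (add_le_add
        ((norm_toeplitzOp_le _ hΦ₂).trans (hΦ₂_le.trans hΦ₁_le))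
        ((norm_potentialOp_le _ hΨ₂).trans (hΨ₂_le.trans hΨ₁_le)))
    · exact hsupp.mono_right (Set.subset_iUnion₂_of_subset τ τ' subset_rfl)
  have hH : ‖cfc κ (hamiltonian (m + 2) Φ Ψ) -
      Polynomial.aeval (hamiltonian (m + 2) Φ Ψ) p‖ ≤ ε / 3 :=
    norm_cfc_sub_aeval_le
      ((isSelfAdjoint_toeplitzOp _ hΦ_symm).add (isSelfAdjoint_potentialOp _ hΨ_real))
      ((norm_add_le _ _).trans (add_le_add (norm_toeplitzOp_le _ hΦs)
        (norm_potentialOp_le _ hΨs))) hκ hδ.le hp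
  obtain ⟨n₀, hn₀⟩ := Filter.eventually_atTop.1
    (hfar.eventually_norm_charOp_comp_le (increasingTuples_subset i) hδ hlimit hH)
  refine ⟨n₀, fun n hn => (hn₀ n hn).trans_eq ?_⟩
  ring
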